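/- Let $\mathbb{B}^{i}=\{x\in\mathbb{R}^3:|x|<1\}$, $\mathbb{B}^{e}=\{x\in\mathbb{R}^3:|x|>1\}$, $J^{i}=\{n\in\mathbb{Z}:n\ge 0\}$, $J^{e}=\{n\in\mathbb{Z}:n\le -2\}$, and let $\sigma$ stand for $i$ or $e$. Write $x=(x_0,x_1,x_2)=(\rho\cos\theta,\rho\sin\theta\cos\phi,\rho\sin\theta\sin\phi)$. For $n\in\mathbb{Z}$ and an integer $m\ge 0$ the solid spherical harmonics are $$U_{n,m}^{\pm}(x)=\rho^n P_n^m(\cos\theta)\,\Phi_m^{\pm}(\phi),\qquad \Phi_m^+(\phi)=\cos(m\phi),\quad \Phi_m^-(\phi)=\sin(m\phi),$$ where $P_n^m(t)=(-1)^m(1-t^2)^{m/2}\frac{d^m}{dt^m}P_n(t)$ with the Legendre polynomial $P_n$ when $n\ge 0$, and $P_n^m=P_{-n-1}^m$ when $n<0$. Let $\mathcal{A}=\{a_0+a_1e_1+a_2e_2: a_j\in\mathbb{R}\}$ be the space of reduced quaternions. For $\mathcal{A}$-valued functions $f=f_0+f_1e_1+f_2e_2$ put $\|f\|_\sigma^2=\int_{\mathbb{B}^\sigma}(f_0^2+f_1^2+f_2^2)\,dV$,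 and let $\alpha_{n,m}=(n+m)(n+m+1)$. For $n\in J^\sigma\setminus\{0\}$ the vector-valued basic contragenics are $$Z_{n,0}^{+}=U_{n,1}^{-}e_1-U_{n,1}^{+}e_2,$$ $$Z_{n,m}^{\pm}=\big(U_{n,m+1}^{\mp}+\alpha_{n,-m}U_{n,m-1}^{\mp}\big)e_1\mp\big(U_{n,m+1}^{\pm}-\alpha_{n,-m}U_{n,m-1}^{\pm}\big)e_2\qquad\big(1\le m\le |n-\tfrac12|-\tfrac12\big)$$ (there is no $Z_{n,0}^-$), and for $n\in J^{e}$ there are in addition the scalar contragenics $Z_{n,-n+1}^{\pm}=U_{n,-n-1}^{\pm}$. **Corollary.** All these functions are square integrable on $\mathbb{B}^\sigma$. For $n\in J^\sigma\setminus\{0\}$ and $0\le m\le |n-\frac12|-\frac12$ (only the sign $+$ when $m=0$), the norms of the vector-valued basic contragenics are $$\|Z_{n,m}^{\pm}\|_\sigma^2=\frac{8\pi\,(n^2+m^2+n)\,\big(|n-\frac12|+m-\frac12\big)!}{(1+\delta_{0,m})(2n+3)(2n+1)\,\big(|n-\frac12|-m-\frac12\big)!},$$ where $\delta_{0,m}$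 is the Kronecker symbol. For $n\in J^{e}$, the norms of the scalar contragenics are $$\|Z_{n,-n+1}^{\pm}\|_{e}^2=\frac{2\pi\,\Gamma(-2n-1)}{(2n+3)(2n+1)}.$$ -/

import Mathlib

open MeasureTheory
open scoped Quaternion Nat

noncomputable section

namespace Contragenic

/-- Euclidean space `ℝ³`, with points `x = (x₀, x₁, x₂)`. -/
abbrev E3 : Type := EuclideanSpace ℝ (Fin 3)

/-- The reduced quaternions: the real subspace `{a₀ + a₁ e₁ + a₂ e₂}` of the quaternions. -/
def reducedQuaternions : Submodule ℝ ℍ[ℝ] where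
  carrier := {a | a.imK = 0}
  add_mem' := by
    intro a b ha hb
    simp only [Set.mem_ofPred_eq] at *
    simp [ha, hb]
  zero_mem' := by simp
  smul_mem' := by
    intro c a ha
    simp only [Set.mem_ofPred_eq] at *
    simp [ha]

/-- The element `a₀ + a₁ e₁ + a₂ e₂`. -/
def ofCoords (a₀ a₁ a₂ : ℝ) : reducedQuaternions :=
  ⟨(⟨a₀, a₁, a₂, 0⟩ : ℍ[ℝ]), rfl⟩

/-- The label `σ`: interior or exterior of the unit sphere. -/
inductive Side
  | int
  | ext

/-- The domain `B^σ`: the open unit ball, or the exterior of the closed unit ball. -/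
def domain : Side → Set E3
  | .int => {x | ‖x‖ < 1}
  | .ext => {x | 1 < ‖x‖}

/-- The set `J^σ` of degrees of the square integrable solid harmonics in `B^σ`. -/
def degrees : Side → Set ℤ
  | .int => {n | 0 ≤ n}
  | .ext => {n | n ≤ -2}

/-- The superscript `±`. -/
inductive Sgn
  | plus
  | minus

/-- The opposite superscript: `∓` where `±` is given. -/
def Sgn.flip : Sgn → Sgn
  | .plus => .minus
  | .minus => .plus

/-- The real number `±1`. -/
def Sgn.val : Sgn → ℝ
  | .plus => 1
  | .minus => -1

/-- The Legendre polynomial `P_k(t) = (1 / (2^k k!)) (d/dt)^k (t² - 1)^k`. -/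
def legendrePoly (k : ℕ) : Polynomial ℝ :=
  Polynomial.C (1 / (2 ^ k * (k ! : ℝ))) *
    Polynomial.derivative^[k] ((Polynomial.X ^ 2 - 1) ^ k)

/-- The associated Legendre function
`P_k^m(t) = (-1)^m (1 - t²)^{m/2} (d/dt)^m P_k(t)`, for `-1 ≤ t ≤ 1` and degree `k ≥ 0`. -/
def legendreNat (k m : ℕ) (t : ℝ) : ℝ :=
  (-1) ^ m * Real.sqrt (1 - t ^ 2) ^ m *
    (Polynomial.derivative^[m] (legendrePoly k)).eval t

/-- The associated Legendre function of integer degree; negative degrees are given by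
`P_{-k}^m = P_{k-1}^m`. -/
def legendre (n : ℤ) (m : ℕ) (t : ℝ) : ℝ :=
  if 0 ≤ n then legendreNat n.toNat m t else legendreNat (-n - 1).toNat m t

/-- `Φ_m^+(φ) = cos (mφ)` and `Φ_m^-(φ) = sin (mφ)`. -/
def trig (m : ℕ) : Sgn → ℝ → ℝ
  | .plus, t => Real.cos (m * t)
  | .minus, t => Real.sin (m * t)

/-- The longitude `φ` of `x = (ρ cos θ, ρ sin θ cos φ, ρ sin θ sin φ)`, up to a multiple
of `2π`. -/
def longitude (x : E3) : ℝ := Complex.arg ⟨x 1, x 2⟩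

/-- The solid spherical harmonic `U_{n,m}^±(x) = ρ^n P_n^m(cos θ) Φ_m^±(φ)`. -/
def U (n : ℤ) (m : ℕ) (s : Sgn) (x : E3) : ℝ :=
  ‖x‖ ^ n * legendre n m (x 0 / ‖x‖) * trig m s (longitude x)

/-- `α_{n,m} = (n + m)(n + m + 1)`. -/
def alpha (n m : ℤ) : ℝ := ((n : ℝ) + m) * ((n : ℝ) + m + 1)

/-- The basic contragenic functions `Z_{n,m}^±`. The first case is `Z_{n,0}^+` (there is no
`Z_{n,0}^-`), the second one is the scalar `Z_{n,-n+1}^± = U_{n,-n-1}^±` of the exterior domain,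
the third one holds the remaining vector-valued functions. -/
def Z (n : ℤ) (m : ℕ) (s : Sgn) (x : E3) : reducedQuaternions :=
  if m = 0 then
    ofCoords 0 (U n 1 .minus x) (-U n 1 .plus x)
  else if n ≤ -2 ∧ (m : ℤ) = -n + 1 then
    ofCoords (U n (-n - 1).toNat s x) 0 0
  else
    ofCoords 0
      (U n (m + 1) s.flip x + alpha n (-m) * U n (m - 1) s.flip x)
      (-s.val * (U n (m + 1) s x - alpha n (-m) * U n (m - 1) s x))

/-- The scalar product `⟨f, g⟩_σ = ∫_{B^σ} (f₀ g₀ + f₁ g₁ + f₂ g₂) dV`. -/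
def scalarProduct (σ : Side) (f g : E3 → reducedQuaternions) : ℝ :=
  ∫ x in domain σ,
    (f x).1.re * (g x).1.re + (f x).1.imI * (g x).1.imI + (f x).1.imJ * (g x).1.imJ

/-- The squared norm `‖f‖_σ²`. -/
def normSq (σ : Side) (f : E3 → reducedQuaternions) : ℝ := scalarProduct σ f f

/-- The natural number `|n - 1/2| - 1/2`, the largest order `m` of a vector-valued `Z_{n,m}^±`. -/
def maxOrder (n : ℤ) : ℕ := if 1 ≤ n then (n - 1).toNat else (-n).toNat

theorem maxOrder_cast (n : ℤ) : (maxOrder n : ℝ) = |(n : ℝ) - 1 / 2| - 1 / 2 := by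
  unfold maxOrder
  split_ifs with h
  · have h1 : (((n - 1).toNat : ℤ) : ℝ) = ((n - 1 : ℤ) : ℝ) := by
      rw [Int.toNat_of_nonneg (by omega)]
    have h2 : (1 : ℝ) ≤ n := by exact_mod_cast h
    rw [abs_of_nonneg (by linarith)]
    push_cast at h1
    rw [h1]
    ring
  · have h1 : (((-n).toNat : ℤ) : ℝ) = ((-n : ℤ) : ℝ) := by
      rw [Int.toNat_of_nonneg (by omega)]
    have h2 : (n : ℝ) ≤ 0 := by exact_mod_cast (by omega : n ≤ 0)
    rw [abs_of_nonpos (by linarith)]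
    push_cast at h1
    rw [h1]
    ring

/-- The Kronecker symbol `δ_{0,m}`. -/
def kronecker (m : ℕ) : ℝ := if m = 0 then 1 else 0

end Contragenic

end

/-! On `domain σ` the squared length of each contragenic separates as `ρ^(2n) G(cos θ, φ)`, so in
spherical coordinates its integral is a radial factor times an angular one. The radial factor, the
integral of `ρ^(2n+2)`, is `1/|2n+3|`, finite exactly because of the admissible degrees. The
computation uses lower Lebesgue integrals, so a finite value also proves square integrability
(`memLp_and_normSq`). For a vector-valued function of order `m ≥ 1`, the cross terms of the two
components add up to a multiple of `cos(2mφ)`, which integrates to zero (`integral_trig_pair`). What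
remains is `2π` times the sum of the squared `L²` norms of `P_k^(m+1)` and `α P_k^(m-1)`, where `k`
is the nonnegative degree attached to `n`. The norms of `P_k^m` follow from Legendre's equation by
integration by parts in `m`, anchored at `m = k` (`integral_legendreSq`). Their combination
collapses through `(k+m)(k+m+1) + (k-m)(k-m+1) = 2(k²+m²+k)`, and `k²+k = n²+n` for both signs of
the degree. -/

namespace Contragenic

/-! ### Norms of the associated Legendre functions. -/

open Polynomial

/-- The differential equation satisfied by the derivatives of `(X² - 1)^k`. -/
theorem iterate_derivative_sq_sub_one_pow_ode (k b : ℕ) :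
    (X ^ 2 - 1) * derivative^[b + 2] ((X ^ 2 - 1 : ℝ[X]) ^ k)
      + 2 * ((b : ℝ[X]) + 1 - (k : ℝ[X])) * X * derivative^[b + 1] ((X ^ 2 - 1 : ℝ[X]) ^ k)
      + ((b : ℝ[X]) + 1) * ((b : ℝ[X]) - 2 * (k : ℝ[X])) * derivative^[b] ((X ^ 2 - 1 : ℝ[X]) ^ k) = 0 := by
  induction b with
  | zero =>
    -- The case `b = 0` is the derivative of this first-order equation; each later case is the
    -- derivative of the one before.
    have h1 : (X ^ 2 - 1) * derivative ((X ^ 2 - 1 : ℝ[X]) ^ k)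
        = 2 * (k : ℝ[X]) * X * (X ^ 2 - 1) ^ k := by
      cases k with
      | zero => simp
      | succ k =>
        rw [derivative_pow]
        simp
        ring
    have h2 := congrArg derivative h1
    simp only [derivative_mul, derivative_sub, derivative_one, derivative_X_pow, derivative_natCast,
      derivative_ofNat, derivative_X] at h2
    simp only [Function.iterate_succ_apply', Function.iterate_zero, id]
    simp [map_ofNat] at h2 ⊢
    linear_combination h2
  | succ b ih =>
    have h2 := congrArg derivative ih
    simp only [derivative_add, derivative_mul, derivative_sub, derivative_one, derivative_X_pow,
      derivative_natCast, derivative_ofNat, derivative_X, derivative_zero,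
      ← Function.iterate_succ_apply' derivative] at h2
    simp [map_ofNat] at h2 ⊢
    linear_combination h2

/-- By Rodrigues' formula this is the previous equation at `b = m + k`, scaled by a negative
constant. -/
theorem legendrePoly_ode (k m : ℕ) :
    (1 - X ^ 2) * derivative^[m + 2] (legendrePoly k)
      - 2 * ((m : ℝ[X]) + 1) * X * derivative^[m + 1] (legendrePoly k)
      + ((k : ℝ[X]) - (m : ℝ[X])) * ((k : ℝ[X]) + (m : ℝ[X]) + 1) * derivative^[m] (legendrePoly k) = 0 := by
  have h := iterate_derivative_sq_sub_one_pow_ode k (m + k)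
  simp only [legendrePoly, iterate_derivative_C_mul, ← Function.iterate_add_apply]
  rw [show m + k + 2 = m + 2 + k by ring, show m + k + 1 = m + 1 + k by ring] at h
  push_cast at h
  linear_combination (-C (1 / (2 ^ k * (k ! : ℝ)))) * h

theorem natDegree_sq_sub_one_pow (k : ℕ) : ((X ^ 2 - 1 : ℝ[X]) ^ k).natDegree = 2 * k := by
  have : (X ^ 2 - 1 : ℝ[X]) = X ^ 2 - C 1 := by simp
  rw [natDegree_pow, this, natDegree_X_pow_sub_C, mul_comm]

theorem iterate_derivative_legendrePoly_self (k : ℕ) :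
    derivative^[k] (legendrePoly k) = C (((2 * k)! : ℝ) / (2 ^ k * (k ! : ℝ))) := by
  have hm : ((X ^ 2 - 1 : ℝ[X]) ^ k).Monic := by
    have : (X ^ 2 - 1 : ℝ[X]) = X ^ 2 - C 1 := by simp
    rw [this]
    exact (monic_X_pow_sub_C 1 two_ne_zero).pow k
  have hd := natDegree_sq_sub_one_pow k
  have h : derivative^[2 * k] ((X ^ 2 - 1 : ℝ[X]) ^ k) = C ((2 * k)! : ℝ) := by
    ext j
    rw [coeff_iterate_derivative, coeff_C]
    split_ifs with hj
    · subst hj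
      have := hm.coeff_natDegree
      rw [hd] at this
      simp [this, Nat.descFactorial_self]
    · rw [coeff_eq_zero_of_natDegree_lt (by omega), smul_zero]
  rw [legendrePoly, iterate_derivative_C_mul, ← Function.iterate_add_apply, ← two_mul, h, ← C_mul]
  congr 1
  ring

theorem iterate_derivative_legendrePoly_of_lt {k m : ℕ} (h : k < m) :
    derivative^[m] (legendrePoly k) = 0 := by
  obtain ⟨j, rfl⟩ : ∃ j, m = j + 1 + k := ⟨m - k - 1, by omega⟩
  rw [Function.iterate_add_apply, iterate_derivative_legendrePoly_self,
    Function.iterate_succ_apply, derivative_C, iterate_derivative_zero]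

theorem integral_eval_derivative (p : ℝ[X]) (a b : ℝ) :
    ∫ t in a..b, (derivative p).eval t = p.eval b - p.eval a :=
  intervalIntegral.integral_eq_sub_of_hasDerivAt (fun x _ => p.hasDerivAt x)
    ((derivative p).continuous.intervalIntegrable _ _)

/-- The weight and square of the associated Legendre function `P_k^m`, as a polynomial. -/
noncomputable def legendreSq (k m : ℕ) : ℝ[X] :=
  (1 - X ^ 2) ^ m * (derivative^[m] (legendrePoly k)) ^ 2

theorem legendreNat_sq (k m : ℕ) {t : ℝ} (ht : t ∈ Set.Icc (-1) 1) :
    legendreNat k m t ^ 2 = (legendreSq k m).eval t := by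
  have h : 0 ≤ 1 - t ^ 2 := by nlinarith [ht.1, ht.2]
  have hs : (Real.sqrt (1 - t ^ 2) ^ m) ^ 2 = (1 - t ^ 2) ^ m := by
    rw [← pow_mul, mul_comm, pow_mul, Real.sq_sqrt h]
  have h1 : (((-1 : ℝ)) ^ m) ^ 2 = 1 := by rw [← pow_mul, mul_comm, pow_mul]; simp
  rw [legendreNat, mul_pow, mul_pow, hs, h1, legendreSq]
  simp

/-- Integration by parts: the product differentiated in `hp` vanishes at `±1`, and Legendre's
equation rewrites its derivative as the difference of the two integrands. -/
theorem integral_legendreSq_succ (k m : ℕ) :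
    ∫ t in (-1 : ℝ)..1, (legendreSq k (m + 1)).eval t
      = ((k : ℝ) - m) * (k + m + 1) * ∫ t in (-1 : ℝ)..1, (legendreSq k m).eval t := by
  have hp : derivative ((1 - X ^ 2) ^ (m + 1) * derivative^[m + 1] (legendrePoly k)
        * derivative^[m] (legendrePoly k))
      = legendreSq k (m + 1) - C (((k : ℝ) - m) * (k + m + 1)) * legendreSq k m := by
    have h := legendrePoly_ode k m
    simp only [legendreSq, derivative_mul, ← Function.iterate_succ_apply' derivative,
      derivative_pow, derivative_sub, derivative_one, derivative_X]
    simp [map_ofNat]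
    simp at h
    linear_combination ((1 - X ^ 2) ^ m * derivative^[m] (legendrePoly k)) * h
  have := integral_eval_derivative ((1 - X ^ 2) ^ (m + 1) * derivative^[m + 1] (legendrePoly k)
        * derivative^[m] (legendrePoly k)) (-1) 1
  rw [hp] at this
  simp only [eval_sub, eval_mul, eval_C] at this
  rw [intervalIntegral.integral_sub ((Polynomial.continuous _).intervalIntegrable _ _)
    (((Polynomial.continuous _).const_mul _).intervalIntegrable _ _),
    intervalIntegral.integral_const_mul] at this
  simp at this
  linarith

/-- The polynomial `X (1 - X²)^(k+1)` vanishes at `±1`, whence `(2k+3) I_(k+1) = (2k+2) I_k` for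
these integrals. -/
theorem integral_one_sub_sq_pow (k : ℕ) :
    (∫ t in (-1 : ℝ)..1, (1 - t ^ 2) ^ k) * (2 * k + 1)! = 2 * 4 ^ k * (k ! : ℝ) ^ 2 := by
  induction k with
  | zero => norm_num
  | succ k ih =>
    have h := integral_eval_derivative (X * (1 - X ^ 2) ^ (k + 1)) (-1) 1
    have hp : ∀ t : ℝ, (derivative (X * (1 - X ^ 2) ^ (k + 1) : ℝ[X])).eval t
        = (2 * k + 3) * (1 - t ^ 2) ^ (k + 1) - (2 * k + 2) * (1 - t ^ 2) ^ k := by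
      intro t
      rw [derivative_mul, derivative_pow]
      simp
      ring
    simp only [hp] at h
    rw [intervalIntegral.integral_sub (Continuous.intervalIntegrable (by fun_prop) _ _)
      (Continuous.intervalIntegrable (by fun_prop) _ _), intervalIntegral.integral_const_mul,
      intervalIntegral.integral_const_mul] at h
    simp at h
    rw [show 2 * (k + 1) + 1 = (2 * k + 1) + 1 + 1 by ring, Nat.factorial_succ,
      Nat.factorial_succ (2 * k + 1), Nat.factorial_succ k]
    push_cast
    rw [pow_succ 4]
    linear_combination (2 * (k:ℝ) + 2) * ((2 * k + 1)! : ℝ) * h + (2 * (k:ℝ) + 2) ^ 2 * ih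

/-- Downward induction on `m`: at `m = k` the derivative of `P_k` is constant and the previous
integral applies. The factor `k - m` of the recursion is absorbed by `(k - m)!`, so only `k + m + 1`
has to be cancelled. -/
theorem integral_legendreSq {k m : ℕ} (h : m ≤ k) :
    (∫ t in (-1 : ℝ)..1, (legendreSq k m).eval t) * (2 * k + 1) * (k - m)! = 2 * (k + m)! := by
  induction h using Nat.decreasingInduction with
  | self =>
    have h1 : ∀ t : ℝ, (legendreSq k k).eval t
        = (((2 * k)! : ℝ) / (2 ^ k * (k ! : ℝ))) ^ 2 * (1 - t ^ 2) ^ k := by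
      intro t
      rw [legendreSq, iterate_derivative_legendrePoly_self]
      simp
      ring
    have h2 := integral_one_sub_sq_pow k
    have h3 : (k ! : ℝ) ≠ 0 := by positivity
    have h4 : ((2 * k) ! : ℝ) ≠ 0 := by positivity
    have h5 : (4 : ℝ) ^ k = 2 ^ k * 2 ^ k := by rw [← mul_pow]; norm_num
    rw [Nat.factorial_succ] at h2
    push_cast at h2
    simp only [h1, intervalIntegral.integral_const_mul, Nat.sub_self, Nat.factorial_zero,
      ← two_mul k]
    rw [h5] at h2
    field_simp
    push_cast
    linear_combination h2
  | of_succ m hm ih =>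
    rw [integral_legendreSq_succ] at ih
    have h1 : k - m = (k - (m + 1)) + 1 := by omega
    have h2 : ((k - (m + 1) : ℕ) : ℝ) + 1 = k - m := by
      rw [Nat.cast_sub hm]; push_cast; ring
    rw [h1, Nat.factorial_succ]
    rw [← add_assoc, Nat.factorial_succ] at ih
    push_cast at ih ⊢
    rw [h2]
    have h3 : (k : ℝ) + m + 1 ≠ 0 := by positivity
    apply mul_left_cancel₀ h3
    linear_combination ih

end Contragenic

/-! ### Spherical coordinates for lower Lebesgue integrals. -/

namespace Contragenic

open Set Real
open scoped ENNReal

theorem norm_toLp_cons (a b c : ℝ) :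
    ‖(WithLp.toLp 2 ![a, b, c] : E3)‖ = √(a ^ 2 + (b ^ 2 + c ^ 2)) := by
  rw [EuclideanSpace.norm_eq, Fin.sum_univ_three]
  simp [add_assoc]

theorem lintegral_E3 (f : E3 → ℝ≥0∞) (hf : Measurable f) :
    ∫⁻ x, f x = ∫⁻ a : ℝ, ∫⁻ q : ℝ × ℝ, f (WithLp.toLp 2 ![a, q.1, q.2]) := by
  have h1 := (PiLp.volume_preserving_toLp (Fin 3)).lintegral_comp hf
  have h2 := (volume_preserving_piFinSuccAbove (fun _ : Fin 3 => ℝ) 0).symm.lintegral_comp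
    (f := fun y => f (WithLp.toLp 2 y)) (by fun_prop)
  rw [← h1, ← h2, Measure.volume_eq_prod, lintegral_prod _ (by fun_prop)]
  refine lintegral_congr fun a => ?_
  have h3 := (volume_preserving_finTwoArrow ℝ).symm.lintegral_comp
    (f := fun y => f (WithLp.toLp 2 ((MeasurableEquiv.piFinSuccAbove (fun _ : Fin 3 => ℝ) 0).symm
      (a, y)))) (by fun_prop)
  rw [← h3]
  refine lintegral_congr fun q => ?_
  congr 2
  ext i
  fin_cases i <;> rfl

theorem lintegral_polar (f : ℝ × ℝ → ℝ≥0∞) (hf : Measurable f) :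
    ∫⁻ p, f p = ∫⁻ r in Ioi 0, ∫⁻ ω in Ioo (-π) π, ENNReal.ofReal r * f (r * cos ω, r * sin ω) := by
  rw [← lintegral_comp_polarCoord_symm, polarCoord_target, Measure.volume_eq_prod,
    ← Measure.prod_restrict, lintegral_prod _ ?_]
  · rfl
  · simp only [polarCoord_symm_apply]
    fun_prop

theorem measurable_longitude : Measurable longitude := by
  unfold longitude
  have : Measurable fun x : E3 => (Complex.measurableEquivRealProd.symm (x 1, x 2)) := by fun_prop
  exact Complex.measurable_arg.comp this

theorem longitude_polar {a r ω : ℝ} (hr : 0 < r) (hω : ω ∈ Ioo (-π) π) :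
    longitude (WithLp.toLp 2 ![a, r * cos ω, r * sin ω]) = ω := by
  have := polarCoord.right_inv (x := (r, ω)) ⟨hr, hω⟩
  exact congrArg Prod.snd this

/-- Integration in spherical coordinates. -/
theorem lintegral_spherical (F : ℝ → ℝ → ℝ → ℝ≥0∞)
    (hF : Measurable fun p : ℝ × ℝ × ℝ => F p.1 p.2.1 p.2.2) :
    ∫⁻ x : E3, F ‖x‖ (x 0 / ‖x‖) (longitude x) =
      ∫⁻ ρ in Ioi (0 : ℝ), ∫⁻ θ in Ioo 0 π, ENNReal.ofReal (ρ ^ 2 * sin θ) *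
        ∫⁻ ω in Ioo (-π) π, F ρ (cos θ) ω := by
  have hm : Measurable fun x : E3 => F ‖x‖ (x 0 / ‖x‖) (longitude x) :=
    hF.comp (f := fun x : E3 => (‖x‖, x 0 / ‖x‖, longitude x))
      (by have := measurable_longitude; fun_prop)
  rw [lintegral_E3 _ hm]
  have hF' : ∀ {α : Type} [MeasurableSpace α] {u v w : α → ℝ}, Measurable u → Measurable v →
      Measurable w → Measurable fun a => F (u a) (v a) (w a) := fun hu hv hw =>
    hF.comp (hu.prodMk (hv.prodMk hw))
  have hin : Measurable fun q : ℝ × ℝ => ∫⁻ ω in Ioo (-π) π, F q.1 q.2 ω :=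
    Measurable.lintegral_prod_right' (f := fun z : (ℝ × ℝ) × ℝ => F z.1.1 z.1.2 z.2)
      (hF' (by fun_prop) (by fun_prop) (by fun_prop))
  -- Polar coordinates are used twice: in the plane `(x₁, x₂)`, then in the half-plane `(x₀, r)`
  -- with `r > 0`. The indicator extends the integrand, with its Jacobian `r`, by zero to the full
  -- plane.
  let G : ℝ × ℝ → ℝ≥0∞ := fun p => indicator (Ioi (0 : ℝ)) (fun r => ENNReal.ofReal r) p.2 *
    ∫⁻ ω in Ioo (-π) π, F (√(p.1 ^ 2 + p.2 ^ 2)) (p.1 / √(p.1 ^ 2 + p.2 ^ 2)) ω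
  have hG : Measurable G := by
    refine Measurable.mul ?_ ?_
    · exact (ENNReal.measurable_ofReal.indicator measurableSet_Ioi).comp measurable_snd
    · exact hin.comp (g := fun q : ℝ × ℝ => ∫⁻ ω in Ioo (-π) π, F q.1 q.2 ω)
        (f := fun p : ℝ × ℝ => (√(p.1 ^ 2 + p.2 ^ 2), p.1 / √(p.1 ^ 2 + p.2 ^ 2))) (by fun_prop)
  have h1 : ∀ a : ℝ, ∫⁻ q : ℝ × ℝ, F ‖(WithLp.toLp 2 ![a, q.1, q.2] : E3)‖
      ((WithLp.toLp 2 ![a, q.1, q.2] : E3) 0 / ‖(WithLp.toLp 2 ![a, q.1, q.2] : E3)‖)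
      (longitude (WithLp.toLp 2 ![a, q.1, q.2])) = ∫⁻ r : ℝ, G (a, r) := by
    intro a
    have ha : Measurable fun q : ℝ × ℝ => (WithLp.toLp 2 ![a, q.1, q.2] : E3) := by
      refine (WithLp.measurable_toLp 2 (Fin 3 → ℝ)).comp (measurable_pi_iff.mpr fun i => ?_)
      fin_cases i
      · exact measurable_const
      · exact measurable_fst
      · exact measurable_snd
    rw [lintegral_polar _ ?_]
    · have : (fun r => G (a, r)) = indicator (Ioi 0) fun r => ENNReal.ofReal r *
          ∫⁻ ω in Ioo (-π) π, F (√(a ^ 2 + r ^ 2)) (a / √(a ^ 2 + r ^ 2)) ω := by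
        funext r
        by_cases hr : r ∈ Ioi (0 : ℝ) <;> simp [G, hr]
      rw [this, lintegral_indicator measurableSet_Ioi]
      refine setLIntegral_congr_fun measurableSet_Ioi fun r hr => ?_
      rw [← lintegral_const_mul' _ _ ENNReal.ofReal_ne_top]
      refine setLIntegral_congr_fun measurableSet_Ioo fun ω hω => ?_
      rw [longitude_polar hr hω, norm_toLp_cons]
      have : (r * cos ω) ^ 2 + (r * sin ω) ^ 2 = r ^ 2 := by
        linear_combination r ^ 2 * sin_sq_add_cos_sq ω
      rw [this]
      rfl
    · exact hm.comp ha
  simp only [h1]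
  rw [← lintegral_prod _ hG.aemeasurable, ← Measure.volume_eq_prod, lintegral_polar _ hG]
  refine setLIntegral_congr_fun measurableSet_Ioi fun ρ (hρ : 0 < ρ) => ?_
  -- Angles `θ ≤ 0` give `r = ρ sin θ ≤ 0`, where `G` vanishes.
  have : ∀ θ ∈ Ioo (-π) π, ENNReal.ofReal ρ * G (ρ * cos θ, ρ * sin θ) = indicator (Ioo 0 π)
      (fun θ => ENNReal.ofReal (ρ ^ 2 * sin θ) * ∫⁻ ω in Ioo (-π) π, F ρ (cos θ) ω) θ := by
    intro θ hθ
    by_cases h : θ ∈ Ioo 0 π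
    · have hs : 0 < sin θ := sin_pos_of_mem_Ioo h
      have h2 : (ρ * cos θ) ^ 2 + (ρ * sin θ) ^ 2 = ρ ^ 2 := by
        linear_combination ρ ^ 2 * sin_sq_add_cos_sq θ
      have h3 : ρ * sin θ ∈ Ioi (0 : ℝ) := mul_pos hρ hs
      rw [indicator_of_mem h]
      simp only [G, indicator_of_mem h3, h2, sqrt_sq hρ.le]
      rw [mul_div_cancel_left₀ _ hρ.ne', ← mul_assoc, ← ENNReal.ofReal_mul hρ.le]
      congr 2
      ring
    · have h4 : θ ≤ 0 := by
        by_contra h5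
        exact h ⟨by linarith, hθ.2⟩
      have hs : sin θ ≤ 0 := sin_nonpos_of_nonpos_of_neg_pi_le h4 hθ.1.le
      have h3 : ρ * sin θ ∉ Ioi (0 : ℝ) := by
        simp only [mem_Ioi, not_lt]
        exact mul_nonpos_of_nonneg_of_nonpos hρ.le hs
      rw [indicator_of_notMem h]
      simp only [G, indicator_of_notMem h3]
      simp
  rw [setLIntegral_congr_fun measurableSet_Ioo this, lintegral_indicator measurableSet_Ioo,
    Measure.restrict_restrict measurableSet_Ioo]
  congr 2
  exact inter_eq_left.mpr (Ioo_subset_Ioo_left (by linarith [pi_pos]))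

end Contragenic

/-! ### Separated integrals over the two domains. -/

namespace Contragenic

open Set Real
open scoped ENNReal

/-- The range of the radius `‖x‖` for `x` in `domain σ`. -/
def radii : Side → Set ℝ
  | .int => Iio 1
  | .ext => Ioi 1

theorem measurableSet_radii (σ : Side) : MeasurableSet (radii σ) := by
  cases σ
  · exact measurableSet_Iio
  · exact measurableSet_Ioi

theorem domain_eq (σ : Side) : domain σ = norm ⁻¹' radii σ := by
  cases σ <;> rfl

theorem measurableSet_domain (σ : Side) : MeasurableSet (domain σ) := by
  rw [domain_eq]
  exact measurable_norm (measurableSet_radii σ)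

/-- The exponent `2n + 2` is at least `2` inside, so there is no singularity at the origin, and at
most `-2` outside, so the integral converges at infinity. -/
theorem lintegral_radial {σ : Side} {n : ℤ} (hn : n ∈ degrees σ) :
    ∫⁻ ρ in Ioi (0 : ℝ) ∩ radii σ, ENNReal.ofReal (ρ ^ n * ρ ^ n * ρ ^ 2)
      = ENNReal.ofReal |2 * (n : ℝ) + 3|⁻¹ := by
  cases σ with
  | int =>
    change 0 ≤ n at hn
    lift n to ℕ using hn
    have hs : Ioi (0 : ℝ) ∩ radii .int = Ioo 0 1 := rfl
    have hf : ∀ ρ : ℝ, ρ ^ (n : ℤ) * ρ ^ (n : ℤ) * ρ ^ 2 = ρ ^ (2 * n + 2) := by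
      intro ρ
      rw [zpow_natCast]
      ring
    simp only [hf]
    rw [hs, ← ofReal_integral_eq_lintegral_ofReal, ← integral_Ioc_eq_integral_Ioo,
      ← intervalIntegral.integral_of_le zero_le_one, integral_pow]
    · congr 1
      rw [abs_of_pos (by positivity)]
      push_cast
      simp
      ring
    · exact ((continuous_pow _).integrableOn_Icc (a := 0) (b := 1)).mono_set Ioo_subset_Icc_self
    · exact (ae_restrict_iff' measurableSet_Ioo).mpr (.of_forall fun ρ hρ => pow_nonneg hρ.1.le _)
  | ext =>
    change n ≤ -2 at hn
    have hs : Ioi (0 : ℝ) ∩ radii .ext = Ioi 1 :=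
      inter_eq_right.mpr (Ioi_subset_Ioi zero_le_one)
    have hn' : (n : ℝ) ≤ -2 := by exact_mod_cast hn
    have hf : ∀ ρ ∈ Ioi (1 : ℝ), ENNReal.ofReal (ρ ^ n * ρ ^ n * ρ ^ 2)
        = ENNReal.ofReal (ρ ^ (2 * (n : ℝ) + 2)) := by
      intro ρ hρ
      have h0 : (0 : ℝ) < ρ := lt_trans zero_lt_one hρ
      congr 1
      rw [← rpow_intCast, ← rpow_natCast, ← rpow_add h0, ← rpow_add h0]
      congr 1
      push_cast
      ring
    rw [hs, setLIntegral_congr_fun measurableSet_Ioi hf, ← ofReal_integral_eq_lintegral_ofReal,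
      integral_Ioi_rpow_of_lt (by linarith) one_pos]
    · congr 1
      rw [abs_of_neg (by linarith), one_rpow, ← neg_inv, ← one_div, neg_div]
      congr 2
      ring
    · exact integrableOn_Ioi_rpow_of_lt (by linarith) one_pos
    · exact (ae_restrict_iff' measurableSet_Ioi).mpr
        (.of_forall fun ρ hρ => rpow_nonneg (zero_le_one.trans (le_of_lt hρ)) _)

theorem lintegral_sin_mul_eval_cos (q : Polynomial ℝ) (hq : ∀ t ∈ Icc (-1 : ℝ) 1, 0 ≤ q.eval t) :
    ∫⁻ θ in Ioo 0 π, ENNReal.ofReal (sin θ * q.eval (cos θ))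
      = ENNReal.ofReal (∫ t in (-1 : ℝ)..1, q.eval t) := by
  have hc : Continuous fun θ => sin θ * q.eval (cos θ) :=
    continuous_sin.mul (q.continuous.comp continuous_cos)
  rw [← ofReal_integral_eq_lintegral_ofReal, ← integral_Ioc_eq_integral_Ioo,
    ← intervalIntegral.integral_of_le pi_pos.le]
  · congr 1
    have h := intervalIntegral.integral_comp_mul_deriv (a := 0) (b := π) (f := cos)
      (f' := fun θ => -sin θ) (g := fun t => q.eval t) (fun x _ => hasDerivAt_cos x)
      (by fun_prop) q.continuous
    rw [cos_zero, cos_pi] at h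
    rw [intervalIntegral.integral_symm 1 (-1), ← h, ← intervalIntegral.integral_neg]
    refine intervalIntegral.integral_congr fun θ _ => ?_
    simp only [Function.comp_apply]
    ring
  · exact (hc.integrableOn_Icc (a := 0) (b := π)).mono_set Ioo_subset_Icc_self
  · refine (ae_restrict_iff' measurableSet_Ioo).mpr (.of_forall fun θ hθ => ?_)
    exact mul_nonneg (sin_pos_of_mem_Ioo hθ).le (hq _ (cos_mem_Icc θ))

/-- Once the longitude is integrated out, only a polynomial in `t = cos θ` is left; its values on
`[-1, 1]` are all that matters. -/
theorem lintegral_domain {σ : Side} {n : ℤ} (hn : n ∈ degrees σ) {G : ℝ → ℝ → ℝ}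
    (hm : Measurable fun p : ℝ × ℝ => G p.1 p.2) (h0 : ∀ t ω, 0 ≤ G t ω)
    (hc : ∀ t, Continuous (G t)) {q : Polynomial ℝ}
    (hq : ∀ t ∈ Icc (-1 : ℝ) 1, ∫ ω in (-π)..π, G t ω = q.eval t) :
    ∫⁻ x in domain σ, ENNReal.ofReal (‖x‖ ^ n * ‖x‖ ^ n * G (x 0 / ‖x‖) (longitude x))
      = ENNReal.ofReal (|2 * (n : ℝ) + 3|⁻¹ * ∫ t in (-1 : ℝ)..1, q.eval t) := by
  have hpi : -π ≤ π := by linarith [pi_pos]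
  have hq0 : ∀ t ∈ Icc (-1 : ℝ) 1, 0 ≤ q.eval t := fun t ht => by
    rw [← hq t ht]
    exact intervalIntegral.integral_nonneg hpi fun ω _ => h0 t ω
  let R : ℝ → ℝ≥0∞ := indicator (radii σ) fun ρ => ENNReal.ofReal (ρ ^ n * ρ ^ n)
  have hR : Measurable R := Measurable.indicator (by fun_prop) (measurableSet_radii σ)
  have hRt : ∀ ρ, R ρ ≠ ⊤ := fun ρ => by
    by_cases h : ρ ∈ radii σ <;> simp [R, h]
  have hsq : ∀ ρ : ℝ, 0 ≤ ρ ^ n * ρ ^ n := fun ρ => mul_self_nonneg _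
  have h1 : ∀ x : E3, (domain σ).indicator (fun x : E3 => ENNReal.ofReal
      (‖x‖ ^ n * ‖x‖ ^ n * G (x 0 / ‖x‖) (longitude x))) x
      = (fun ρ t ω => R ρ * ENNReal.ofReal (G t ω)) ‖x‖ (x 0 / ‖x‖) (longitude x) := by
    intro x
    rw [domain_eq]
    by_cases h : ‖x‖ ∈ radii σ
    · rw [indicator_of_mem (by exact h)]
      simp only [R, indicator_of_mem h]
      rw [← ENNReal.ofReal_mul (hsq _)]
    · rw [indicator_of_notMem (by exact h)]
      simp [R, indicator_of_notMem h]
  rw [← lintegral_indicator (measurableSet_domain σ), lintegral_congr h1,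
    lintegral_spherical (fun ρ t ω => R ρ * ENNReal.ofReal (G t ω)) ?_]
  · have h2 : ∀ t ∈ Icc (-1 : ℝ) 1, ∫⁻ ω in Ioo (-π) π, ENNReal.ofReal (G t ω)
        = ENNReal.ofReal (q.eval t) := by
      intro t ht
      rw [← hq t ht, intervalIntegral.integral_of_le hpi, integral_Ioc_eq_integral_Ioo,
        ofReal_integral_eq_lintegral_ofReal]
      · exact ((hc t).integrableOn_Icc (a := -π) (b := π)).mono_set Ioo_subset_Icc_self
      · exact .of_forall fun ω => h0 t ω
    have h3 : ∀ ρ ∈ Ioi (0 : ℝ), ∫⁻ θ in Ioo 0 π, ENNReal.ofReal (ρ ^ 2 * sin θ) *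
        ∫⁻ ω in Ioo (-π) π, R ρ * ENNReal.ofReal (G (cos θ) ω)
        = (radii σ).indicator (fun ρ => ENNReal.ofReal (ρ ^ n * ρ ^ n * ρ ^ 2)) ρ
          * ENNReal.ofReal (∫ t in (-1 : ℝ)..1, q.eval t) := by
      intro ρ hρ
      rw [← lintegral_sin_mul_eval_cos q hq0, ← lintegral_const_mul' _ _ ?_]
      · refine setLIntegral_congr_fun measurableSet_Ioo fun θ hθ => ?_
        rw [lintegral_const_mul' _ _ (hRt ρ), h2 _ (cos_mem_Icc θ),
          ENNReal.ofReal_mul (sq_nonneg ρ), ENNReal.ofReal_mul (sin_pos_of_mem_Ioo hθ).le]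
        by_cases h : ρ ∈ radii σ
        · simp only [R, indicator_of_mem h]
          rw [ENNReal.ofReal_mul (hsq ρ)]
          ring
        · simp [R, indicator_of_notMem h]
      · by_cases h : ρ ∈ radii σ <;> simp [h]
    rw [setLIntegral_congr_fun measurableSet_Ioi h3, lintegral_mul_const' _ _ ENNReal.ofReal_ne_top,
      lintegral_indicator (measurableSet_radii σ), Measure.restrict_restrict (measurableSet_radii σ),
      inter_comm, lintegral_radial hn, ENNReal.ofReal_mul (by positivity)]
  · refine Measurable.mul (hR.comp measurable_fst) (ENNReal.measurable_ofReal.comp ?_)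
    exact hm.comp measurable_snd

theorem ofCoords_eq (a b c : ℝ) :
    ofCoords a b c = a • ofCoords 1 0 0 + b • ofCoords 0 1 0 + c • ofCoords 0 0 1 := by
  apply Subtype.ext
  ext
  · change a = a * 1 + b * 0 + c * 0
    ring
  · change b = a * 0 + b * 1 + c * 0
    ring
  · change c = a * 0 + b * 0 + c * 1
    ring
  · change 0 = a * 0 + b * 0 + c * 0
    ring

theorem norm_ofCoords_sq (a b c : ℝ) : ‖ofCoords a b c‖ ^ 2 = a * a + b * b + c * c := by
  rw [← Submodule.norm_coe, sq, ← Quaternion.normSq_eq_norm_mul_self, Quaternion.normSq_def']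
  simp [ofCoords]
  ring

/-- Norm of a reduced quaternion valued function that splits in spherical coordinates. -/
theorem memLp_and_normSq {σ : Side} {n : ℤ} (hn : n ∈ degrees σ) {G : ℝ → ℝ → ℝ}
    (hm : Measurable fun p : ℝ × ℝ => G p.1 p.2) (h0 : ∀ t ω, 0 ≤ G t ω)
    (hc : ∀ t, Continuous (G t)) {q : Polynomial ℝ}
    (hq : ∀ t ∈ Icc (-1 : ℝ) 1, ∫ ω in (-π)..π, G t ω = q.eval t)
    {a b c : E3 → ℝ} (ha : Measurable a) (hb : Measurable b) (hc' : Measurable c)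
    (habc : ∀ x, a x * a x + b x * b x + c x * c x
      = ‖x‖ ^ n * ‖x‖ ^ n * G (x 0 / ‖x‖) (longitude x)) :
    MemLp (fun x => ofCoords (a x) (b x) (c x)) 2 (volume.restrict (domain σ)) ∧
    normSq σ (fun x => ofCoords (a x) (b x) (c x))
      = |2 * (n : ℝ) + 3|⁻¹ * ∫ t in (-1 : ℝ)..1, q.eval t := by
  have hl := lintegral_domain hn hm h0 hc hq
  have hmeas : Measurable fun x => a x * a x + b x * b x + c x * c x := by fun_prop
  have hnn : ∀ x, 0 ≤ a x * a x + b x * b x + c x * c x := fun x =>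
    add_nonneg (add_nonneg (mul_self_nonneg _) (mul_self_nonneg _)) (mul_self_nonneg _)
  have hq0 : 0 ≤ ∫ t in (-1 : ℝ)..1, q.eval t :=
    intervalIntegral.integral_nonneg (by norm_num) fun t ht => by
      rw [← hq t ht]
      exact intervalIntegral.integral_nonneg (by linarith [pi_pos]) fun ω _ => h0 t ω
  simp only [← habc] at hl
  constructor
  · rw [memLp_two_iff_integrable_sq_norm]
    · simp only [norm_ofCoords_sq]
      -- The integrand is nonnegative, so finiteness of its lower integral is integrability.
      rw [← lintegral_ofReal_ne_top_iff_integrable hmeas.aestronglyMeasurable (.of_forall hnn), hl]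
      exact ENNReal.ofReal_ne_top
    · have : (fun x => ofCoords (a x) (b x) (c x)) = fun x =>
          a x • ofCoords 1 0 0 + b x • ofCoords 0 1 0 + c x • ofCoords 0 0 1 :=
        funext fun x => ofCoords_eq _ _ _
      rw [this]
      exact (((ha.stronglyMeasurable.smul_const _).add (hb.stronglyMeasurable.smul_const _)).add
        (hc'.stronglyMeasurable.smul_const _)).aestronglyMeasurable
  · change ∫ x in domain σ, a x * a x + b x * b x + c x * c x = _
    rw [integral_eq_lintegral_of_nonneg_ae (.of_forall hnn) hmeas.aestronglyMeasurable, hl,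
      ENNReal.toReal_ofReal (by positivity)]

end Contragenic

/-! ### Angular integrals of the contragenics. -/

namespace Contragenic

open Set Real

/-- The nonnegative degree `k` with `P_n^m = P_k^m`. -/
def natDegree (n : ℤ) : ℕ := if 0 ≤ n then n.toNat else (-n - 1).toNat

theorem legendre_eq (n : ℤ) (m : ℕ) (t : ℝ) : legendre n m t = legendreNat (natDegree n) m t := by
  unfold legendre natDegree
  split_ifs <;> rfl

theorem abs_two_mul_add_one (n : ℤ) : |2 * (n : ℝ) + 1| = 2 * (natDegree n : ℝ) + 1 := by
  unfold natDegree
  split_ifs with h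
  · lift n to ℕ using h
    rw [abs_of_nonneg (by positivity)]
    simp
  · obtain ⟨k, hk⟩ : ∃ k : ℕ, n = -k - 1 := ⟨(-n - 1).toNat, by omega⟩
    subst hk
    have : (-(-(k : ℤ) - 1) - 1).toNat = k := by omega
    rw [this, abs_of_nonpos (by push_cast; linarith [(Nat.cast_nonneg k : (0 : ℝ) ≤ k)])]
    push_cast
    ring

/-- The only integer between the roots `-3/2` and `-1/2` is `-1`, which belongs to neither set of
degrees. -/
theorem abs_mul_abs_of_mem_degrees {σ : Side} {n : ℤ} (hn : n ∈ degrees σ) :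
    |2 * (n : ℝ) + 3| * |2 * (n : ℝ) + 1| = (2 * (n : ℝ) + 3) * (2 * (n : ℝ) + 1) := by
  rw [← abs_mul, abs_of_nonneg]
  cases σ with
  | int =>
    have : (0 : ℝ) ≤ n := by exact_mod_cast (show 0 ≤ n from hn)
    positivity
  | ext =>
    have : (n : ℝ) ≤ -2 := by exact_mod_cast (show n ≤ -2 from hn)
    nlinarith

theorem continuous_legendreNat (k m : ℕ) : Continuous (legendreNat k m) := by
  unfold legendreNat
  have := (Polynomial.derivative^[m] (legendrePoly k)).continuous
  fun_prop

theorem continuous_trig (m : ℕ) (s : Sgn) : Continuous (trig m s) := by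
  cases s <;> (unfold trig; fun_prop)

theorem measurable_U (n : ℤ) (m : ℕ) (s : Sgn) : Measurable (U n m s) := by
  unfold U
  simp only [legendre_eq]
  have h1 := (continuous_legendreNat (natDegree n) m).measurable
  have h2 := (continuous_trig m s).measurable
  have h3 := measurable_longitude
  fun_prop

theorem U_eq (n : ℤ) (m : ℕ) (s : Sgn) (x : E3) :
    U n m s x = ‖x‖ ^ n * (legendreNat (natDegree n) m (x 0 / ‖x‖) * trig m s (longitude x)) := by
  rw [U, legendre_eq, mul_assoc]

theorem integral_cos_two_mul_nat {m : ℕ} (hm : m ≠ 0) :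
    ∫ ω in (-π)..π, cos (2 * m * ω) = 0 := by
  have h : (2 * (m : ℝ)) ≠ 0 := by positivity
  have h1 : sin (2 * m * π) = 0 := by
    have := sin_nat_mul_pi (2 * m)
    push_cast at this
    exact this
  rw [intervalIntegral.integral_comp_mul_left _ h, integral_cos]
  simp [h1]

theorem integral_trig_sq {m : ℕ} (hm : m ≠ 0) (s : Sgn) :
    ∫ ω in (-π)..π, trig m s ω ^ 2 = π := by
  have h : ∀ ω : ℝ, trig m s ω ^ 2 = 1 / 2 + s.val / 2 * cos (2 * m * ω) := by
    intro ω
    rw [mul_assoc, cos_two_mul]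
    cases s <;> simp only [trig, Sgn.val]
    · ring
    · rw [sin_sq]; ring
  simp only [h]
  rw [intervalIntegral.integral_add (Continuous.intervalIntegrable (by fun_prop) _ _)
    (Continuous.intervalIntegrable (by fun_prop) _ _), intervalIntegral.integral_const_mul,
    integral_cos_two_mul_nat hm]
  simp
  ring

/-- The squares combine by `sin² + cos² = 1`, and the cross terms by the addition formula into the
frequency `(j+2) + j = 2(j+1)`. The case `j = 0` therefore needs no separate treatment. -/
theorem integral_trig_pair (A B : ℝ) (j : ℕ) (s : Sgn) :
    ∫ ω in (-π)..π, ((A * trig (j + 1 + 1) s.flip ω + B * trig j s.flip ω) ^ 2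
      + (A * trig (j + 1 + 1) s ω - B * trig j s ω) ^ 2) = 2 * π * (A ^ 2 + B ^ 2) := by
  have h : ∀ ω : ℝ, (A * trig (j + 1 + 1) s.flip ω + B * trig j s.flip ω) ^ 2
      + (A * trig (j + 1 + 1) s ω - B * trig j s ω) ^ 2
      = (A ^ 2 + B ^ 2) + -(2 * s.val * A * B) * cos (2 * (j + 1 : ℕ) * ω) := by
    intro ω
    have e : 2 * ((j + 1 : ℕ) : ℝ) * ω = ((j + 1 + 1 : ℕ) : ℝ) * ω + (j : ℝ) * ω := by
      push_cast; ring
    have h1 := sin_sq_add_cos_sq (((j + 1 + 1 : ℕ) : ℝ) * ω)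
    have h2 := sin_sq_add_cos_sq ((j : ℝ) * ω)
    rw [e, cos_add]
    cases s <;> simp only [trig, Sgn.val, Sgn.flip] <;>
      linear_combination A ^ 2 * h1 + B ^ 2 * h2
  simp only [h]
  rw [intervalIntegral.integral_add (Continuous.intervalIntegrable (by fun_prop) _ _)
    (Continuous.intervalIntegrable (by fun_prop) _ _), intervalIntegral.integral_const_mul,
    integral_cos_two_mul_nat (Nat.succ_ne_zero j)]
  simp
  ring

theorem integral_legendreSq_eq_zero {k m : ℕ} (h : k < m) :
    ∫ t in (-1 : ℝ)..1, (legendreSq k m).eval t = 0 := by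
  simp [legendreSq, iterate_derivative_legendrePoly_of_lt h]

theorem Z_zero_eq (n : ℤ) (s : Sgn) :
    Z n 0 s = fun x => ofCoords 0 (U n 1 .minus x) (-U n 1 .plus x) := by
  funext x
  simp [Z]

theorem memLp_and_normSq_Z_zero {σ : Side} {n : ℤ} (hn : n ∈ degrees σ) (s : Sgn) :
    MemLp (Z n 0 s) 2 (volume.restrict (domain σ)) ∧
    normSq σ (Z n 0 s) = |2 * (n : ℝ) + 3|⁻¹ *
      (2 * π * ∫ t in (-1 : ℝ)..1, (legendreSq (natDegree n) 1).eval t) := by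
  have h1 := (continuous_legendreNat (natDegree n) 1).measurable
  have := memLp_and_normSq hn (G := fun t _ => legendreNat (natDegree n) 1 t ^ 2)
    (q := Polynomial.C (2 * π) * legendreSq (natDegree n) 1)
    (by fun_prop) (fun _ _ => sq_nonneg _) (fun _ => continuous_const)
    (fun t ht => by
      rw [intervalIntegral.integral_const, legendreNat_sq _ _ ht, smul_eq_mul, Polynomial.eval_mul,
        Polynomial.eval_C]
      ring)
    (a := fun _ => 0) (b := U n 1 .minus) (c := fun x => -U n 1 .plus x)
    measurable_const (measurable_U _ _ _) (measurable_U _ _ _).neg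
    (fun x => by
      rw [U_eq, U_eq]
      simp only [trig]
      linear_combination (‖x‖ ^ n) ^ 2 * legendreNat (natDegree n) 1 (x 0 / ‖x‖) ^ 2 *
        sin_sq_add_cos_sq (((1 : ℕ) : ℝ) * longitude x))
  rw [Z_zero_eq]
  simpa using this

theorem memLp_and_normSq_Z_succ {σ : Side} {n : ℤ} (hn : n ∈ degrees σ) (j : ℕ) (s : Sgn)
    (hj : ¬(n ≤ -2 ∧ ((j + 1 : ℕ) : ℤ) = -n + 1)) :
    MemLp (Z n (j + 1) s) 2 (volume.restrict (domain σ)) ∧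
    normSq σ (Z n (j + 1) s) = |2 * (n : ℝ) + 3|⁻¹ *
      (2 * π * ((∫ t in (-1 : ℝ)..1, (legendreSq (natDegree n) (j + 2)).eval t)
        + alpha n (-(j + 1 : ℕ)) ^ 2 * ∫ t in (-1 : ℝ)..1, (legendreSq (natDegree n) j).eval t)) := by
  set k := natDegree n with hk
  set α := alpha n (-(j + 1 : ℕ)) with hα
  have h1 := continuous_legendreNat k (j + 1 + 1)
  have h2 := continuous_legendreNat k j
  have h3 := continuous_trig (j + 1 + 1)
  have h4 := continuous_trig j
  have hs : s.val ^ 2 = 1 := by cases s <;> simp [Sgn.val]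
  have hU := fun (m : ℕ) (s : Sgn) => measurable_U n m s
  have := memLp_and_normSq hn
    (G := fun t ω => (legendreNat k (j + 1 + 1) t * trig (j + 1 + 1) s.flip ω
        + α * legendreNat k j t * trig j s.flip ω) ^ 2
      + (legendreNat k (j + 1 + 1) t * trig (j + 1 + 1) s ω
        - α * legendreNat k j t * trig j s ω) ^ 2)
    (q := Polynomial.C (2 * π) * (legendreSq k (j + 2) + Polynomial.C (α ^ 2) * legendreSq k j))
    (Continuous.measurable (by fun_prop)) (fun _ _ => by positivity) (fun _ => by fun_prop)
    (fun t ht => by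
      rw [integral_trig_pair, mul_pow, legendreNat_sq _ _ ht, legendreNat_sq _ _ ht]
      simp)
    (a := fun _ => 0)
    (b := fun x => U n (j + 1 + 1) s.flip x + α * U n j s.flip x)
    (c := fun x => -s.val * (U n (j + 1 + 1) s x - α * U n j s x))
    measurable_const (by fun_prop) (by fun_prop)
    (fun x => by
      simp only [U_eq, ← hk]
      linear_combination (‖x‖ ^ n) ^ 2 * (legendreNat k (j + 1 + 1) (x 0 / ‖x‖)
        * trig (j + 1 + 1) s (longitude x) - α * legendreNat k j (x 0 / ‖x‖)
        * trig j s (longitude x)) ^ 2 * hs)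
  have hZ : Z n (j + 1) s = fun x => ofCoords 0 (U n (j + 1 + 1) s.flip x + α * U n j s.flip x)
      (-s.val * (U n (j + 1 + 1) s x - α * U n j s x)) := by
    funext x
    simp only [Z, if_neg (Nat.succ_ne_zero j), if_neg hj, ← hα]
    rfl
  rw [hZ]
  refine ⟨this.1, this.2.trans ?_⟩
  congr 1
  simp only [Polynomial.eval_mul, Polynomial.eval_C, Polynomial.eval_add]
  rw [intervalIntegral.integral_const_mul, intervalIntegral.integral_add
    ((Polynomial.continuous _).intervalIntegrable _ _)
    (((Polynomial.continuous _).const_mul _).intervalIntegrable _ _),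
    intervalIntegral.integral_const_mul]

theorem memLp_and_normSq_Z_scalar {n : ℤ} (hn : n ≤ -2) (s : Sgn) :
    MemLp (Z n (-n + 1).toNat s) 2 (volume.restrict (domain .ext)) ∧
    normSq .ext (Z n (-n + 1).toNat s) = |2 * (n : ℝ) + 3|⁻¹ *
      (π * ∫ t in (-1 : ℝ)..1, (legendreSq (natDegree n) (natDegree n)).eval t) := by
  have hk : natDegree n = (-n - 1).toNat := if_neg (by omega)
  have hk0 : natDegree n ≠ 0 := by omega
  set k := natDegree n with hkn
  have h1 := continuous_legendreNat k k
  have h2 := continuous_trig k s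
  have := memLp_and_normSq (σ := .ext) hn
    (G := fun t ω => legendreNat k k t ^ 2 * trig k s ω ^ 2)
    (q := Polynomial.C π * legendreSq k k)
    (Continuous.measurable (by fun_prop)) (fun _ _ => by positivity) (fun _ => by fun_prop)
    (fun t ht => by
      rw [intervalIntegral.integral_const_mul, integral_trig_sq hk0, legendreNat_sq _ _ ht]
      simp
      ring)
    (a := U n k s) (b := fun _ => 0) (c := fun _ => 0)
    (measurable_U _ _ _) measurable_const measurable_const
    (fun x => by
      rw [U_eq, ← hkn]
      ring)
  have hZ : Z n (-n + 1).toNat s = fun x => ofCoords (U n k s x) 0 0 := by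
    funext x
    rw [Z, if_neg (by omega), if_pos ⟨hn, by omega⟩, hk]
  rw [hZ]
  simpa using this

/-- With `m = j + 1` and `d = k - m - 1`, the factor `α = (d+1)(d+2)` turns `(d+2)!` into `d!`. Both
terms then share `2(k+m-1)!`, with cofactors `(k+m)(k+m+1)` and `(k-m)(k-m+1)`. -/
theorem sum_integral_legendreSq_int {j k : ℕ} (h : j + 2 ≤ k) :
    ((∫ t in (-1 : ℝ)..1, (legendreSq k (j + 2)).eval t)
      + (((k : ℝ) - (j + 1)) * (k - (j + 1) + 1)) ^ 2
        * ∫ t in (-1 : ℝ)..1, (legendreSq k j).eval t) * (2 * k + 1) * (k - 1 - (j + 1))!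
      = 4 * ((k : ℝ) ^ 2 + (j + 1) ^ 2 + k) * (k - 1 + (j + 1))! := by
  obtain ⟨d, rfl⟩ := Nat.exists_eq_add_of_le h
  have h1 := integral_legendreSq (k := j + 2 + d) (m := j + 2) (by omega)
  have h2 := integral_legendreSq (k := j + 2 + d) (m := j) (by omega)
  rw [show j + 2 + d - (j + 2) = d by omega,
    show j + 2 + d + (j + 2) = 2 * j + d + 2 + 1 + 1 by ring] at h1
  rw [show j + 2 + d - j = d + 1 + 1 by omega, show j + 2 + d + j = 2 * j + d + 2 by ring] at h2
  rw [show j + 2 + d - 1 - (j + 1) = d by omega,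
    show j + 2 + d - 1 + (j + 1) = 2 * j + d + 2 by omega]
  simp only [Nat.factorial_succ (2 * j + d + 2 + 1), Nat.factorial_succ (2 * j + d + 2),
    Nat.factorial_succ (d + 1), Nat.factorial_succ d] at h1 h2
  push_cast at h1 h2 ⊢
  linear_combination h1 + ((d : ℝ) + 1) * (d + 2) * h2

/-- For `n = -k-1` one has `α = (k+m)(k+m+1)` with `m = j + 1`, so the common factor is now
`2(k+m+1)!` and the cofactors are the same as inside. -/
theorem sum_integral_legendreSq_ext {j k : ℕ} (h : j ≤ k) :
    ((∫ t in (-1 : ℝ)..1, (legendreSq k (j + 2)).eval t)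
      + ((-(k : ℝ) - 1 - (j + 1)) * (-(k : ℝ) - 1 - (j + 1) + 1)) ^ 2
        * ∫ t in (-1 : ℝ)..1, (legendreSq k j).eval t) * (2 * k + 1) * (k + 1 - (j + 1))!
      = 4 * ((k : ℝ) ^ 2 + (j + 1) ^ 2 + k) * (k + 1 + (j + 1))! := by
  obtain ⟨d, rfl⟩ := Nat.exists_eq_add_of_le h
  have h2 := integral_legendreSq (k := j + d) (m := j) (by omega)
  -- For `d = 0` and `d = 1` the order `j + 2` exceeds the degree; the integral vanishes and so does
  -- `d(d-1)`.
  have h1 : (∫ t in (-1 : ℝ)..1, (legendreSq (j + d) (j + 2)).eval t)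
      * (2 * (j + d : ℕ) + 1) * d ! = 2 * (d * (d - 1)) * (j + d + 1 + (j + 1))! := by
    rcases d with _ | _ | d
    · rw [integral_legendreSq_eq_zero (by omega)]
      simp
    · rw [integral_legendreSq_eq_zero (by omega)]
      simp
    · have h1 := integral_legendreSq (k := j + (d + 1 + 1)) (m := j + 2) (by omega)
      rw [show j + (d + 1 + 1) - (j + 2) = d by omega,
        show j + (d + 1 + 1) + (j + 2) = j + (d + 1 + 1) + 1 + (j + 1) by ring] at h1
      rw [Nat.factorial_succ (d + 1), Nat.factorial_succ d]
      push_cast at h1 ⊢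
      linear_combination ((d : ℝ) + 1) * (d + 2) * h1
  rw [show j + d - j = d by omega] at h2
  rw [show j + d + 1 - (j + 1) = d by omega]
  rw [show j + d + 1 + (j + 1) = j + d + j + 1 + 1 by ring] at h1 ⊢
  simp only [Nat.factorial_succ (j + d + j + 1), Nat.factorial_succ (j + d + j)] at h1 ⊢
  push_cast at h1 h2 ⊢
  linear_combination h1 + ((2 * (j : ℝ) + d + 2) * (2 * j + d + 1)) ^ 2 * h2

theorem integral_legendreSq_one {k : ℕ} (h : 1 ≤ k) :
    (∫ t in (-1 : ℝ)..1, (legendreSq k 1).eval t) * (2 * k + 1) = 2 * ((k : ℝ) ^ 2 + k) := by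
  obtain ⟨d, rfl⟩ := Nat.exists_eq_add_of_le' h
  have h1 := integral_legendreSq h
  have hd : (d ! : ℝ) ≠ 0 := by positivity
  simp only [Nat.add_sub_cancel, Nat.factorial_succ (d + 1), Nat.factorial_succ d] at h1
  apply mul_right_cancel₀ hd
  push_cast at h1 ⊢
  linear_combination h1

end Contragenic

/-! ### Closed forms of the norms. -/

namespace Contragenic

open Real

theorem normSq_formula_zero {σ : Side} {n : ℤ} (hn : n ∈ degrees σ) (h0 : n ≠ 0) :
    |2 * (n : ℝ) + 3|⁻¹ *
      (2 * π * ∫ t in (-1 : ℝ)..1, (legendreSq (natDegree n) 1).eval t)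
      = 4 * π * ((n : ℝ) ^ 2 + n) / ((2 * n + 3) * (2 * n + 1)) := by
  have hk : 1 ≤ natDegree n ∧ ((natDegree n : ℝ) ^ 2 + natDegree n = (n : ℝ) ^ 2 + n) := by
    unfold natDegree
    cases σ with
    | int =>
      change 0 ≤ n at hn
      lift n to ℕ using hn
      simp at h0 ⊢
      omega
    | ext =>
      change n ≤ -2 at hn
      obtain ⟨k, rfl⟩ : ∃ k : ℕ, n = -k - 1 := ⟨(-n - 1).toNat, by omega⟩
      rw [if_neg (by omega), show (-(-(k : ℤ) - 1) - 1).toNat = k by omega]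
      refine ⟨by omega, ?_⟩
      push_cast
      ring
  have hI := integral_legendreSq_one hk.1
  rw [hk.2, ← abs_two_mul_add_one] at hI
  have h1 : |2 * (n : ℝ) + 1| ≠ 0 := by rw [abs_two_mul_add_one]; positivity
  have h3 : |2 * (n : ℝ) + 3| ≠ 0 := by
    rw [abs_ne_zero]
    exact_mod_cast (by omega : 2 * n + 3 ≠ 0)
  rw [← abs_mul_abs_of_mem_degrees hn]
  field_simp
  linear_combination 2 * hI

theorem normSq_formula_succ {σ : Side} {n : ℤ} (hn : n ∈ degrees σ) (h0 : n ≠ 0) {j : ℕ}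
    (hj : j + 1 ≤ maxOrder n) :
    |2 * (n : ℝ) + 3|⁻¹ *
      (2 * π * ((∫ t in (-1 : ℝ)..1, (legendreSq (natDegree n) (j + 2)).eval t)
        + alpha n (-(j + 1 : ℕ)) ^ 2 * ∫ t in (-1 : ℝ)..1, (legendreSq (natDegree n) j).eval t))
      = 8 * π * ((n : ℝ) ^ 2 + ((j + 1 : ℕ) : ℝ) ^ 2 + n) * ((maxOrder n + (j + 1))! : ℝ)
        / ((2 * n + 3) * (2 * n + 1) * ((maxOrder n - (j + 1))! : ℝ)) := by
  have hI : ((∫ t in (-1 : ℝ)..1, (legendreSq (natDegree n) (j + 2)).eval t)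
        + alpha n (-(j + 1 : ℕ)) ^ 2 * ∫ t in (-1 : ℝ)..1, (legendreSq (natDegree n) j).eval t)
        * (2 * natDegree n + 1) * (maxOrder n - (j + 1))!
      = 4 * ((n : ℝ) ^ 2 + ((j + 1 : ℕ) : ℝ) ^ 2 + n) * (maxOrder n + (j + 1))! := by
    cases σ with
    | int =>
      change 0 ≤ n at hn
      lift n to ℕ using hn
      have hk : natDegree n = n := by simp [natDegree]
      have hM : maxOrder n = n - 1 := by
        unfold maxOrder
        split_ifs <;> omega
      rw [hM] at hj
      rw [hk, hM]
      have := sum_integral_legendreSq_int (j := j) (k := n) (by omega)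
      unfold alpha
      push_cast at this ⊢
      linear_combination this
    | ext =>
      change n ≤ -2 at hn
      obtain ⟨k, rfl⟩ : ∃ k : ℕ, n = -k - 1 := ⟨(-n - 1).toNat, by omega⟩
      have hk : natDegree (-(k : ℤ) - 1) = k := by
        rw [natDegree, if_neg (by omega)]
        omega
      have hM : maxOrder (-(k : ℤ) - 1) = k + 1 := by
        rw [maxOrder, if_neg (by omega)]
        omega
      rw [hM] at hj
      rw [hk, hM]
      have := sum_integral_legendreSq_ext (j := j) (k := k) (by omega)
      unfold alpha
      push_cast at this ⊢
      linear_combination this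
  rw [← abs_two_mul_add_one] at hI
  have h1 : |2 * (n : ℝ) + 1| ≠ 0 := by rw [abs_two_mul_add_one]; positivity
  have h3 : |2 * (n : ℝ) + 3| ≠ 0 := by
    rw [abs_ne_zero]
    exact_mod_cast (by omega : 2 * n + 3 ≠ 0)
  have h4 : ((maxOrder n - (j + 1))! : ℝ) ≠ 0 := by positivity
  rw [← abs_mul_abs_of_mem_degrees hn, eq_div_iff (by positivity), inv_mul_eq_div,
    div_mul_eq_mul_div, div_eq_iff h3]
  linear_combination 2 * π * |2 * (n : ℝ) + 3| * hI

theorem normSq_formula_scalar {n : ℤ} (hn : n ≤ -2) :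
    |2 * (n : ℝ) + 3|⁻¹ *
      (π * ∫ t in (-1 : ℝ)..1, (legendreSq (natDegree n) (natDegree n)).eval t)
      = 2 * π * Real.Gamma (-2 * (n : ℝ) - 1) / ((2 * n + 3) * (2 * n + 1)) := by
  have hI := integral_legendreSq (le_refl (natDegree n))
  rw [← abs_two_mul_add_one] at hI
  -- With `n = -k-1` the argument is `2k + 1`.
  have hG : Real.Gamma (-2 * (n : ℝ) - 1) = ((natDegree n + natDegree n)! : ℝ) := by
    obtain ⟨k, rfl⟩ : ∃ k : ℕ, n = -k - 1 := ⟨(-n - 1).toNat, by omega⟩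
    have hk : natDegree (-(k : ℤ) - 1) = k := by
      rw [natDegree, if_neg (by omega)]
      omega
    rw [hk, ← Real.Gamma_nat_eq_factorial]
    congr 1
    push_cast
    ring
  have h1 : |2 * (n : ℝ) + 1| ≠ 0 := by rw [abs_two_mul_add_one]; positivity
  have h3 : |2 * (n : ℝ) + 3| ≠ 0 := by
    rw [abs_ne_zero]
    exact_mod_cast (by omega : 2 * n + 3 ≠ 0)
  rw [← abs_mul_abs_of_mem_degrees (σ := .ext) hn, hG]
  rw [Nat.sub_self, Nat.factorial_zero, Nat.cast_one, mul_one] at hI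
  field_simp
  linear_combination hI

end Contragenic

theorem mainTheorem8 :
    (∀ (σ : Contragenic.Side) (n : ℤ) (m : ℕ) (s : Contragenic.Sgn),
      n ∈ Contragenic.degrees σ \ {0} →
      m ≤ Contragenic.maxOrder n →
      (m = 0 → s = Contragenic.Sgn.plus) →
      MemLp (Contragenic.Z n m s) 2 (volume.restrict (Contragenic.domain σ)) ∧
      Contragenic.normSq σ (Contragenic.Z n m s) =
        8 * Real.pi * ((n : ℝ) ^ 2 + (m : ℝ) ^ 2 + n) * ((Contragenic.maxOrder n + m)! : ℝ) /
          ((1 + Contragenic.kronecker m) * (2 * (n : ℝ) + 3) * (2 * (n : ℝ) + 1) *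
            ((Contragenic.maxOrder n - m)! : ℝ))) ∧
    (∀ (n : ℤ) (s : Contragenic.Sgn),
      n ∈ Contragenic.degrees Contragenic.Side.ext →
      MemLp (Contragenic.Z n (-n + 1).toNat s) 2
        (volume.restrict (Contragenic.domain Contragenic.Side.ext)) ∧
      Contragenic.normSq Contragenic.Side.ext (Contragenic.Z n (-n + 1).toNat s) =
        2 * Real.pi * Real.Gamma (-2 * (n : ℝ) - 1) /
          ((2 * (n : ℝ) + 3) * (2 * (n : ℝ) + 1))) := by
  refine ⟨fun σ n m s hn hm _ => ?_, fun n s hn => ?_⟩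
  · obtain ⟨hn, h0⟩ := hn
    cases m with
    | zero =>
      obtain ⟨h1, h2⟩ := Contragenic.memLp_and_normSq_Z_zero hn s
      refine ⟨h1, h2.trans ((Contragenic.normSq_formula_zero hn h0).trans ?_)⟩
      have h4 : ((Contragenic.maxOrder n)! : ℝ) ≠ 0 := by positivity
      -- At `m = 0` the two factorials cancel, and `1 + δ = 2` reduces `8π` to `4π`.
      simp only [Contragenic.kronecker, if_true, Nat.add_zero, Nat.sub_zero, Nat.cast_zero]
      rw [mul_div_mul_right _ _ h4]
      rw [show (1 + 1 : ℝ) * (2 * (n : ℝ) + 3) * (2 * (n : ℝ) + 1)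
        = 2 * ((2 * (n : ℝ) + 3) * (2 * (n : ℝ) + 1)) by ring, ← mul_div_mul_left _ _ two_ne_zero]
      ring
    | succ j =>
      -- The scalar contragenic has order `-n + 1`, one above `maxOrder n = -n`.
      have hj : ¬(n ≤ -2 ∧ ((j + 1 : ℕ) : ℤ) = -n + 1) := by
        rintro ⟨h1, h2⟩
        rw [Contragenic.maxOrder, if_neg (by omega)] at hm
        omega
      obtain ⟨h1, h2⟩ := Contragenic.memLp_and_normSq_Z_succ hn j s hj
      refine ⟨h1, h2.trans ((Contragenic.normSq_formula_succ hn h0 hm).trans ?_)⟩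
      simp [Contragenic.kronecker]
  · obtain ⟨h1, h2⟩ := Contragenic.memLp_and_normSq_Z_scalar hn s
    exact ⟨h1, h2.trans (Contragenic.normSq_formula_scalar hn)⟩
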